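/- A Lorentzian matrix is a real symmetric matrix with nonnegative entries that has at most one positive eigenvalue (counted with multiplicity). For $n\ge 0$ let $\mathbb{L}_n^+$ be the set of $n\times n$ Lorentzian matrices all of whose entries are positive, and let $\underline{\mathbb{L}}_n^+$ be the set of matrices in $\mathbb{L}_n^+$ whose diagonal entries are all equal to $1$. The set of bounded ratios on $\mathbb{L}_n^+$ is $$\mathrm{BR}(\mathbb{L}_n^+)=\Bigl\{(\alpha_{ij})_{1\le i\le j\le n}\in\mathbb{R}^{\binom{n+1}{2}} \;\Big|\; \text{there is } c>0 \text{ such that } \prod_{1\le i\le j\le n}p_{ij}^{\alpha_{ij}}\le c \text{ for all } (p_{ij})\in\mathbb{L}_n^+\Bigr\},$$ and the set of reduced bounded ratios on $\mathbb{L}_n^+$ is $$\underline{\mathrm{BR}}(\mathbb{L}_n^+)=\Bigl\{(\alpha_{ij})_{1\le i<j\le n}\in\mathbb{R}^{\binom{n}{2}} \;\Big|\; \text{there is } c>0 \text{ such that } \prod_{1\le i<j\le n}p_{ij}^{\alpha_{ij}}\le c \text{ for all } (p_{ij})\in\underline{\mathbb{L}}_n^+\Bigr\}.$$ For $S\subseteq\{1,\dots,n\}$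 let $\delta(S)=(\delta(S)_{ij})_{1\le i<j\le n}$ be the cut vector, where $\delta(S)_{ij}=1$ if $S$ contains exactly one of $i$ and $j$, and $\delta(S)_{ij}=0$ otherwise. The cut cone $\mathrm{Cut}_n\subseteq\mathbb{R}^{\binom n2}$ is the convex cone generated by all the cut vectors $\delta(S)$, $S\subseteq\{1,\dots,n\}$. Theorem. For every $n$, $$\underline{\mathrm{BR}}(\mathbb{L}_n^+)=\Bigl\{(\alpha_{ij})_{1\le i<j\le n} \;\Big|\; \sum_{1\le i<j\le n}\alpha_{ij}\beta_{ij}\le 0 \ \text{ for all } (\beta_{ij})_{1\le i<j\le n}\in\mathrm{Cut}_n\Bigr\}.$$ In particular, $\mathrm{BR}(\mathbb{L}_n^+)$ is a finitely generated integral polyhedral cone: it is the convex cone generated by a finite set of vectors with integer entries, and it is the intersection of finitely many closed linear half-spaces $\{x\mid \sum_{i\le j} a_{ij}x_{ij}\le 0\}$ with integer coefficients $a_{ij}$. -/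

import Mathlib

namespace LorentzianRatios

/-- A Lorentzian matrix: a real symmetric matrix with nonnegative entries that has at most one
positive eigenvalue (eigenvalues are counted with multiplicity). -/
def IsLorentzian {n : ℕ} (p : Matrix (Fin n) (Fin n) ℝ) : Prop :=
  (∀ i j, 0 ≤ p i j) ∧
    ∃ hp : p.IsHermitian, (Finset.univ.filter fun i => 0 < hp.eigenvalues i).card ≤ 1

/-- The set `𝕃_n^+` of Lorentzian `n × n` matrices all of whose entries are positive. -/
def LorentzianPos (n : ℕ) : Set (Matrix (Fin n) (Fin n) ℝ) :=
  {p | IsLorentzian p ∧ ∀ i j, 0 < p i j}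

/-- Index pairs `i ≤ j`; real functions on this type are the vectors `(α_ij)_{i ≤ j}`. -/
abbrev WeakPair (n : ℕ) : Type := {e : Fin n × Fin n // e.1 ≤ e.2}

/-- Index pairs `i < j`; real functions on this type are the vectors `(α_ij)_{i < j}`. -/
abbrev StrictPair (n : ℕ) : Type := {e : Fin n × Fin n // e.1 < e.2}

/-- The set of bounded ratios on a set `X` of (symmetric, entrywise positive) matrices. -/
def BR {n : ℕ} (X : Set (Matrix (Fin n) (Fin n) ℝ)) : Set (WeakPair n → ℝ) :=
  {α | ∃ c : ℝ, 0 < c ∧ ∀ p ∈ X, ∏ e : WeakPair n, p e.1.1 e.1.2 ^ α e ≤ c}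

/-- The normalized members of `X`: those with all diagonal entries equal to `1`. -/
def normalized {n : ℕ} (X : Set (Matrix (Fin n) (Fin n) ℝ)) : Set (Matrix (Fin n) (Fin n) ℝ) :=
  {p | p ∈ X ∧ ∀ i, p i i = 1}

/-- The set of reduced bounded ratios on a set `X` of (symmetric, entrywise positive) matrices. -/
def reducedBR {n : ℕ} (X : Set (Matrix (Fin n) (Fin n) ℝ)) : Set (StrictPair n → ℝ) :=
  {α | ∃ c : ℝ, 0 < c ∧ ∀ p ∈ normalized X, ∏ e : StrictPair n, p e.1.1 e.1.2 ^ α e ≤ c}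

/-- The cut vector `δ(S)`: its entry at `i < j` is `1` if `S` contains exactly one of `i` and `j`,
and `0` otherwise. -/
def cutVector {n : ℕ} (S : Finset (Fin n)) : StrictPair n → ℝ :=
  fun e => if (e.1.1 ∈ S ↔ e.1.2 ∈ S) then 0 else 1

/-- The cut cone: the convex cone generated by all cut vectors. -/
def cutCone (n : ℕ) : PointedCone ℝ (StrictPair n → ℝ) :=
  PointedCone.hull ℝ (Set.range (cutVector (n := n)))

/-- `C` is the convex cone generated by finitely many integer vectors. -/
def IsFinGenIntegral {ι : Type} (C : Set (ι → ℝ)) : Prop :=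
  ∃ s : Finset (ι → ℤ),
    C = (PointedCone.hull ℝ ((fun (v : ι → ℤ) (k : ι) => (v k : ℝ)) '' (s : Set (ι → ℤ))) :
      Set (ι → ℝ))

/-- `C` is the intersection of finitely many closed linear half-spaces with integer coefficients. -/
def IsIntegralPolyhedral {ι : Type} [Fintype ι] (C : Set (ι → ℝ)) : Prop :=
  ∃ s : Finset (ι → ℤ), C = {x | ∀ a ∈ s, ∑ k, (a k : ℝ) * x k ≤ 0}

end LorentzianRatios

namespace LorentzianRatios

/-! Up to bounded error, the logarithms of normalized Lorentzian entries fill out the cut cone, so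
boundedness of a ratio is polarity to that cone.

Cuts are attained: `exp_cut_mem_LorentzianPos` shows that the exponential of any nonnegative
multiple of a cut, even after diagonal scaling, is Lorentzian. Letting the multiple grow forces each
cut inequality.

Conversely, put q_ij = p_ij / (p_iw p_jw) for a fixed w. The signature condition yields q_ik ≤
2(q_ij + q_jk), so log q is ultrametric up to log 4. Merging closest pairs, as in building a tree,
places such a function, minus half its diagonal terms, near the cut cone (`exists_cutFnCone_near`).

For unreduced ratios, diagonal scaling adds one linear equation per index. Finitely many integer
inequalities remain, and the double description method turns them into integer generators. -/

/-! ### Signature and quadratic forms -/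

open Matrix in
theorem quadForm_eq_sum_eigenvalues {n : ℕ} {p : Matrix (Fin n) (Fin n) ℝ} (hp : p.IsHermitian) :
    ∃ U : Matrix (Fin n) (Fin n) ℝ, Uᵀ * U = 1 ∧
      ∀ x, x ⬝ᵥ p *ᵥ x = ∑ i, hp.eigenvalues i * (Uᵀ *ᵥ x) i ^ 2 := by
  refine ⟨hp.eigenvectorUnitary.1, ?_, fun x => ?_⟩
  · have := Unitary.coe_star_mul_self hp.eigenvectorUnitary
    rwa [star_eq_conjTranspose, conjTranspose_eq_transpose_of_trivial] at this
  · set U : Matrix (Fin n) (Fin n) ℝ := hp.eigenvectorUnitary.1 with hU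
    have h := hp.spectral_theorem
    rw [Unitary.conjStarAlgAut_apply, ← hU, star_eq_conjTranspose,
      conjTranspose_eq_transpose_of_trivial] at h
    conv_lhs => rw [h]
    rw [← mulVec_mulVec, ← mulVec_mulVec, dotProduct_mulVec, ← mulVec_transpose]
    simp only [dotProduct, mulVec_diagonal]
    refine Finset.sum_congr rfl fun i _ => ?_
    simp
    ring

open Matrix in
/-- At most one eigenvalue is positive iff the quadratic form is nonpositive on a hyperplane. -/
theorem card_pos_eigenvalues_le_one_iff {n : ℕ} {p : Matrix (Fin n) (Fin n) ℝ}
    (hp : p.IsHermitian) :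
    (Finset.univ.filter fun i => 0 < hp.eigenvalues i).card ≤ 1 ↔
      ∃ l : Fin n → ℝ, ∀ v, l ⬝ᵥ v = 0 → v ⬝ᵥ p *ᵥ v ≤ 0 := by
  obtain ⟨U, hU, hQ⟩ := quadForm_eq_sum_eigenvalues hp
  constructor
  · intro h
    rw [Finset.card_le_one] at h
    by_cases hex : ∃ i, 0 < hp.eigenvalues i
    · obtain ⟨i, hi⟩ := hex
      refine ⟨Uᵀ i, fun v hv => ?_⟩
      rw [hQ]
      refine Finset.sum_nonpos fun j _ => ?_
      by_cases hj : 0 < hp.eigenvalues j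
      · have : j = i := h j (by simpa using hj) i (by simpa using hi)
        subst this
        have h0 : (Uᵀ *ᵥ v) j = 0 := hv
        simp [h0]
      · exact mul_nonpos_of_nonpos_of_nonneg (not_lt.1 hj) (sq_nonneg _)
    · push Not at hex
      refine ⟨0, fun v _ => ?_⟩
      rw [hQ]
      exact Finset.sum_nonpos fun j _ =>
        mul_nonpos_of_nonpos_of_nonneg (hex j) (sq_nonneg _)
  · rintro ⟨l, hl⟩
    rw [Finset.card_le_one]
    intro i hi j hj
    by_contra hij
    simp only [Finset.mem_filter, Finset.mem_univ, true_and] at hi hj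
    have key : ∀ a b : ℝ, a * (l ⬝ᵥ U *ᵥ Pi.single i 1) + b * (l ⬝ᵥ U *ᵥ Pi.single j 1) = 0 →
        hp.eigenvalues i * a ^ 2 + hp.eigenvalues j * b ^ 2 ≤ 0 := by
      intro a b hab
      have hx := hl (U *ᵥ (a • Pi.single i 1 + b • Pi.single j 1)) (by
        simpa [mulVec_add, mulVec_smul] using hab)
      rw [hQ, mulVec_mulVec, hU, one_mulVec, ← Finset.add_sum_erase _ _ (Finset.mem_univ i),
        ← Finset.add_sum_erase _ _ (Finset.mem_erase.2 ⟨Ne.symm hij, Finset.mem_univ j⟩),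
        Finset.sum_eq_zero] at hx
      · simpa [hij, Ne.symm hij] using hx
      · intro k hk
        simp only [Finset.mem_erase] at hk
        simp [hk.1, hk.2.1]
    -- The plane spanned by two positive eigenvectors meets the kernel of `l` in a nonzero vector,
    -- where the form would be positive.
    by_cases h0 : l ⬝ᵥ U *ᵥ Pi.single i 1 = 0
    · have := key 1 0 (by rw [h0]; ring)
      linarith
    · have := key (-(l ⬝ᵥ U *ᵥ Pi.single j 1)) (l ⬝ᵥ U *ᵥ Pi.single i 1) (by ring)
      have h1 : 0 < hp.eigenvalues j * (l ⬝ᵥ U *ᵥ Pi.single i 1) ^ 2 := by positivity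
      have h2 : 0 ≤ hp.eigenvalues i * (-(l ⬝ᵥ U *ᵥ Pi.single j 1)) ^ 2 := by positivity
      linarith

-- Here `v` is `p`-orthogonal to the basis vector at `w`, whose square is positive. Shifting `v` by
-- `t` times that vector reaches the hyperplane and adds only `t² * p w w` to the form.
open Matrix in
theorem IsLorentzian.quadForm_nonpos {n : ℕ} {p : Matrix (Fin n) (Fin n) ℝ} (h : IsLorentzian p)
    {w : Fin n} (hw : 0 < p w w) {v : Fin n → ℝ} (hv : (p *ᵥ v) w = 0) : v ⬝ᵥ p *ᵥ v ≤ 0 := by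
  obtain ⟨-, hp, hc⟩ := h
  obtain ⟨l, hl⟩ := (card_pos_eigenvalues_le_one_iff hp).1 hc
  have hlw : l w ≠ 0 := by
    intro h0
    have := hl (Pi.single w 1) (by simp [h0])
    simp at this
    linarith
  have hT : pᵀ = p := by
    rw [← conjTranspose_eq_transpose_of_trivial]
    exact hp
  set t := (l ⬝ᵥ v) / l w with ht
  have hx := hl (v - Pi.single w t) (by
    rw [dotProduct_sub, dotProduct_single, ht]
    field_simp
    ring)
  have hcross : v ⬝ᵥ p *ᵥ Pi.single w t = 0 := by
    rw [dotProduct_mulVec, ← mulVec_transpose, hT, dotProduct_single, hv, zero_mul]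
  rw [mulVec_sub, dotProduct_sub, sub_dotProduct, sub_dotProduct, hcross, single_dotProduct, hv,
    single_dotProduct, mulVec_single] at hx
  simp at hx
  nlinarith [mul_nonneg (mul_self_nonneg t) hw.le]

open Matrix in
/-- In the rescaled coordinates based at `w`, the entries satisfy a weak triangle inequality. -/
theorem IsLorentzian.rescaled_triangle {n : ℕ} {p : Matrix (Fin n) (Fin n) ℝ}
    (h : IsLorentzian p) (hpos : ∀ i j, 0 < p i j) (w i j k : Fin n) :
    p i k / (p i w * p k w) ≤
      2 * (p i j / (p i w * p j w) + p j k / (p j w * p k w)) := by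
  have hs : ∀ a b, p a b = p b a := fun a b => by
    have := h.2.1.apply b a
    simpa using this
  -- The weights 1, -2, 1 cancel in row `w`. In the expanded form the diagonal terms are positive
  -- and can be dropped.
  have hq := h.quadForm_nonpos (hpos w w)
    (v := Pi.single i (p i w)⁻¹ + Pi.single j (-2 * (p j w)⁻¹) + Pi.single k (p k w)⁻¹) (by
      have hi := (hpos i w).ne'
      have hj := (hpos j w).ne'
      have hk := (hpos k w).ne'
      simp only [mulVec_add, mulVec_single, Pi.add_apply, Pi.smul_apply, col_apply,
        MulOpposite.smul_eq_mul_unop, MulOpposite.unop_op, hs w]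
      field_simp
      ring)
  simp only [mulVec_add, mulVec_single, dotProduct_add, add_dotProduct, single_dotProduct,
    Pi.smul_apply, col_apply, MulOpposite.smul_eq_mul_unop, MulOpposite.unop_op,
    hs j i, hs k i, hs k j] at hq
  have hi := (hpos i w)
  have hj := (hpos j w)
  have hk := (hpos k w)
  have e1 : 0 < (p i w)⁻¹ * (p i i * (p i w)⁻¹) := by have := hpos i i; positivity
  have e2 : 0 < (p j w)⁻¹ * (p j j * (p j w)⁻¹) := by have := hpos j j; positivity
  have e3 : 0 < (p k w)⁻¹ * (p k k * (p k w)⁻¹) := by have := hpos k k; positivity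
  simp only [div_eq_mul_inv, mul_inv]
  linarith

/-! ### Approximate ultrametrics and the cut cone -/

/-- The cut function of `S` on ordered pairs. -/
def cutFn {V : Type} [DecidableEq V] (S : Finset V) : V × V → ℝ :=
  fun e => if (e.1 ∈ S ↔ e.2 ∈ S) then 0 else 1

/-- The cone of functions on ordered pairs generated by the cut functions. -/
def cutFnCone (V : Type) [DecidableEq V] : PointedCone ℝ (V × V → ℝ) :=
  PointedCone.hull ℝ (Set.range (cutFn (V := V)))

theorem cutFn_mem_cutFnCone {V : Type} [DecidableEq V] (S : Finset V) :
    cutFn S ∈ cutFnCone V :=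
  PointedCone.subset_hull ⟨S, rfl⟩

theorem cutFnCone_diag {V : Type} [DecidableEq V] {β : V × V → ℝ} (hβ : β ∈ cutFnCone V) (a : V) :
    β (a, a) = 0 := by
  induction hβ using Submodule.span_induction with
  | mem x hx => obtain ⟨S, rfl⟩ := hx; simp [cutFn]
  | zero => rfl
  | add x y _ _ hx hy => simp [hx, hy]
  | smul c x _ hx => simp [hx]

theorem cutFnCone_symm {V : Type} [DecidableEq V] {β : V × V → ℝ} (hβ : β ∈ cutFnCone V)
    (a b : V) : β (a, b) = β (b, a) := by
  induction hβ using Submodule.span_induction with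
  | mem x hx => obtain ⟨S, rfl⟩ := hx; simp [cutFn, iff_comm]
  | zero => rfl
  | add x y _ _ hx hy => simp [hx, hy]
  | smul c x _ hx => simp [hx]

/-- Cuts pull back to cuts of preimages; this is used to undo the merging of two points. -/
theorem cutFnCone_comp {V : Type} [Fintype V] [DecidableEq V] {β : V × V → ℝ}
    (hβ : β ∈ cutFnCone V) (r : V → V) : (fun e => β (r e.1, r e.2)) ∈ cutFnCone V := by
  induction hβ using Submodule.span_induction with
  | mem x hx =>
    obtain ⟨S, rfl⟩ := hx
    have : (fun e : V × V => cutFn S (r e.1, r e.2)) =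
        cutFn (Finset.univ.filter fun a => r a ∈ S) := by
      funext e; simp [cutFn]
    rw [this]
    exact cutFn_mem_cutFnCone _
  | zero => exact zero_mem _
  | add x y _ _ hx hy => exact add_mem hx hy
  | smul c x _ hx => exact Submodule.smul_mem _ c hx

theorem abs_max_zero_sub_le {x d : ℝ} (hd : 0 ≤ d) (hx : -d ≤ x) : |max 0 x - x| ≤ d := by
  rcases le_total 0 x with h | h
  · rw [max_eq_right h]; simpa using hd
  · rw [max_eq_left h, abs_le]; constructor <;> linarith

/-- A function satisfying the ultrametric inequality up to an additive constant gives, after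
subtracting diagonal terms, a function close to the cut cone. -/
theorem exists_cutFnCone_near {V : Type} [Fintype V] [DecidableEq V] {c : ℝ} (hc : 0 ≤ c) (m : ℕ) :
    ∀ (T : Finset V) (g : V → V → ℝ), T.card = m → (∀ a b, g a b = g b a) →
      (∀ a ∈ T, ∀ b ∈ T, ∀ d ∈ T, g a d ≤ max (g a b) (g b d) + c) →
      ∃ β ∈ cutFnCone V, ∀ a ∈ T, ∀ b ∈ T, a ≠ b →
        |g a b - (g a a + g b b) / 2 - β (a, b)| ≤ 2 * c * m := by
  induction m with
  | zero =>
    intro T g hT _ _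
    rw [Finset.card_eq_zero] at hT
    subst hT
    exact ⟨0, zero_mem _, by simp⟩
  | succ m ih =>
    intro T g hT hs hg
    by_cases hne : T.offDiag.Nonempty
    swap
    · refine ⟨0, zero_mem _, fun a ha b hb hab => (hne ⟨(a, b), ?_⟩).elim⟩
      simp [ha, hb, hab]
    obtain ⟨⟨i, j⟩, hij, hmin⟩ := T.offDiag.exists_min_image (fun e => g e.1 e.2) hne
    simp only [Finset.mem_offDiag, Prod.forall] at hij hmin
    obtain ⟨hi, hj, hne'⟩ := hij
    -- Merge the closest pair: `i` now stands for both points, with diagonal value `g i j`.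
    -- Minimality of `g i j` preserves the approximate ultrametric inequality.
    let g' : V → V → ℝ := fun a b => if a = i ∧ b = i then g i j else g a b
    have hg'ii : g' i i = g i j := by simp [g']
    have hg'l : ∀ a b, a ≠ i → g' a b = g a b := fun a b h => by simp [g', h]
    have hg'r : ∀ a b, b ≠ i → g' a b = g a b := fun a b h => by simp [g', h]
    obtain ⟨β, hβ, hb⟩ := ih (T.erase j) g' (by rw [Finset.card_erase_of_mem hj, hT]; rfl)
      (fun a b => by simp only [g', and_comm, hs a b]) (by
        intro a ha b hb d hd
        simp only [Finset.mem_erase] at ha hb hd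
        by_cases hai : a = i
        · subst hai
          by_cases hba : b = a
          · subst hba
            linarith [le_max_right (g' b b) (g' b d)]
          · rw [hg'r a b hba, hg'l b d hba]
            by_cases hda : d = a
            · subst hda
              rw [hg'ii]
              have := hmin d b ⟨ha.2, hb.2, Ne.symm hba⟩
              linarith [le_max_left (g d b) (g b d)]
            · rw [hg'r a d hda]
              exact hg a ha.2 b hb.2 d hd.2
        · rw [hg'l a d hai, hg'l a b hai]
          by_cases hbd : b = i ∧ d = i
          · obtain ⟨rfl, rfl⟩ := hbd
            linarith [le_max_left (g a d) (g' d d)]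
          · have : g' b d = g b d := if_neg hbd
            rw [this]
            exact hg a ha.2 b hb.2 d hd.2)
    let r : V → V := fun a => if a = j then i else a
    have hrj : r j = i := by simp [r]
    have hr : ∀ a, a ≠ j → r a = a := fun a h => by simp [r, h]
    -- Changing the diagonal from `g i j` back to `g a a` requires a pendant length `(g i j - g a a)
    -- / 2`. For `a = i, j` it is at least `-c / 2`, so truncation at zero costs at most `c / 2`.
    let s : V → ℝ := fun a => max 0 ((g i j - g a a) / 2)
    have hsi : |s i - (g i j - g i i) / 2| ≤ c / 2 := by
      refine abs_max_zero_sub_le (by linarith) ?_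
      have := hg i hi j hj i hi
      rw [hs j i, max_self] at this
      linarith
    have hsj : |s j - (g i j - g j j) / 2| ≤ c / 2 := by
      refine abs_max_zero_sub_le (by linarith) ?_
      have := hg j hj i hi j hj
      rw [hs j i, max_self] at this
      linarith
    let γ : V × V → ℝ := (fun e => β (r e.1, r e.2)) + s i • cutFn {i} + s j • cutFn {j}
    have hγ : γ ∈ cutFnCone V :=
      add_mem (add_mem (cutFnCone_comp hβ r)
        (PointedCone.smul_mem _ (le_max_left _ _) (cutFn_mem_cutFnCone _)))
        (PointedCone.smul_mem _ (le_max_left _ _) (cutFn_mem_cutFnCone _))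
    have hγij : γ (i, j) = s i + s j := by
      have : γ (i, j) = β (r i, r j) + s i * cutFn {i} (i, j) + s j * cutFn {j} (i, j) := rfl
      rw [this, hrj, hr i hne', cutFnCone_diag hβ]
      simp [cutFn, hne', Ne.symm hne']
    have hγi : ∀ k, k ≠ i → k ≠ j → γ (i, k) = β (i, k) + s i := by
      intro k hki hkj
      have : γ (i, k) = β (r i, r k) + s i * cutFn {i} (i, k) + s j * cutFn {j} (i, k) := rfl
      rw [this, hr i hne', hr k hkj]
      simp [cutFn, hne', hki, hkj]
    have hγj : ∀ k, k ≠ i → k ≠ j → γ (j, k) = β (i, k) + s j := by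
      intro k hki hkj
      have : γ (j, k) = β (r j, r k) + s i * cutFn {i} (j, k) + s j * cutFn {j} (j, k) := rfl
      rw [this, hrj, hr k hkj]
      simp [cutFn, Ne.symm hne', hki, hkj]
    have hγo : ∀ a b, a ≠ i → a ≠ j → b ≠ i → b ≠ j → γ (a, b) = β (a, b) := by
      intro a b hai haj hbi hbj
      have : γ (a, b) = β (r a, r b) + s i * cutFn {i} (a, b) + s j * cutFn {j} (a, b) := rfl
      rw [this, hr a haj, hr b hbj]
      simp [cutFn, hai, haj, hbi, hbj]
    have hm : 0 ≤ 2 * c * (m : ℝ) := by positivity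
    have eij : |g i j - (g i i + g j j) / 2 - γ (i, j)| ≤ 2 * c * (m + 1 : ℕ) := by
      rw [hγij]
      push_cast
      rw [abs_le] at *
      constructor <;> linarith [hsi.1, hsi.2, hsj.1, hsj.2]
    have eik : ∀ k ∈ T, k ≠ i → k ≠ j →
        |g i k - (g i i + g k k) / 2 - γ (i, k)| ≤ 2 * c * (m + 1 : ℕ) := by
      intro k hk hki hkj
      have h1 := hb i (by simp [hi, hne']) k (by simp [hk, hkj]) (Ne.symm hki)
      rw [hg'ii, hg'r i k hki, hg'r k k hki] at h1
      rw [hγi k hki hkj]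
      push_cast
      rw [abs_le] at *
      constructor <;> linarith [hsi.1, hsi.2, h1.1, h1.2]
    have ejk : ∀ k ∈ T, k ≠ i → k ≠ j →
        |g j k - (g j j + g k k) / 2 - γ (j, k)| ≤ 2 * c * (m + 1 : ℕ) := by
      intro k hk hki hkj
      have h1 := hb i (by simp [hi, hne']) k (by simp [hk, hkj]) (Ne.symm hki)
      rw [hg'ii, hg'r i k hki, hg'r k k hki] at h1
      have m1 := hmin i k ⟨hi, hk, Ne.symm hki⟩
      have m2 := hmin j k ⟨hj, hk, Ne.symm hkj⟩
      -- As `g i j` is minimal, rows `i` and `j` differ by at most `c` at `k`, so the merged point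
      -- also serves for `j`.
      have u1 := hg i hi j hj k hk
      have u2 := hg j hj i hi k hk
      rw [max_eq_right m2] at u1
      rw [hs j i, max_eq_right m1] at u2
      rw [hγj k hki hkj]
      push_cast
      rw [abs_le] at *
      constructor <;> linarith [hsj.1, hsj.2, h1.1, h1.2]
    refine ⟨γ, hγ, fun a ha b hb' hab => ?_⟩
    have flip : ∀ a b, |g b a - (g b b + g a a) / 2 - γ (b, a)| ≤ 2 * c * (m + 1 : ℕ) →
        |g a b - (g a a + g b b) / 2 - γ (a, b)| ≤ 2 * c * (m + 1 : ℕ) := by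
      intro a b h
      rwa [hs a b, add_comm (g a a), cutFnCone_symm hγ]
    by_cases hai : a = i
    · subst hai
      by_cases hbj : b = j
      · subst hbj; exact eij
      · exact eik b hb' (Ne.symm hab) hbj
    by_cases haj : a = j
    · subst haj
      by_cases hbi : b = i
      · subst hbi; exact flip _ _ eij
      · exact ejk b hb' hbi (Ne.symm hab)
    by_cases hbi : b = i
    · subst hbi; exact flip _ _ (eik a ha hai haj)
    by_cases hbj : b = j
    · subst hbj; exact flip _ _ (ejk a ha hai haj)
    have h1 := hb a (by simp [ha, haj]) b (by simp [hb', hbj]) hab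
    rw [hg'l a b hai, hg'l a a hai, hg'l b b hbi] at h1
    rw [hγo a b hai haj hbi hbj]
    push_cast
    linarith

/-- The logarithms of the normalized entries of a Lorentzian matrix are close to the cut cone. -/
theorem exists_cutFnCone_near_log (n : ℕ) : ∃ C : ℝ, ∀ p ∈ LorentzianPos n,
    ∃ β ∈ cutFnCone (Fin n), ∀ i j,
      |Real.log (p i j) - (Real.log (p i i) + Real.log (p j j)) / 2 - β (i, j)| ≤ C := by
  have h4 : 0 ≤ Real.log 4 := Real.log_nonneg (by norm_num)
  refine ⟨2 * Real.log 4 * n, fun p hp => ?_⟩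
  rcases isEmpty_or_nonempty (Fin n) with _ | ⟨⟨w⟩⟩
  · exact ⟨0, zero_mem _, fun i => isEmptyElim i⟩
  obtain ⟨hL, hpos⟩ := hp
  have hs : ∀ a b, p a b = p b a := fun a b => by simpa using hL.2.1.apply b a
  -- The rescaling factors cancel once half the diagonal logarithms are subtracted.
  let q : Fin n → Fin n → ℝ := fun i j => p i j / (p i w * p j w)
  have hq : ∀ i j, 0 < q i j := fun i j => div_pos (hpos i j) (mul_pos (hpos i w) (hpos j w))
  have hlog : ∀ i j, Real.log (q i j) =
      Real.log (p i j) - (Real.log (p i w) + Real.log (p j w)) := fun i j => by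
    rw [Real.log_div (hpos i j).ne' (mul_pos (hpos i w) (hpos j w)).ne',
      Real.log_mul (hpos i w).ne' (hpos j w).ne']
  obtain ⟨β, hβ, hb⟩ := exists_cutFnCone_near h4 n (Finset.univ : Finset (Fin n))
    (fun i j => Real.log (q i j)) (by simp) (fun a b => by simp only [q, hs a b, mul_comm]) (by
      intro i _ j _ k _
      have ht : q i k ≤ 2 * (q i j + q j k) := hL.rescaled_triangle hpos w i j k
      rcases le_total (q i j) (q j k) with h | h
      · have := Real.log_le_log (hq i k) (show q i k ≤ q j k * 4 by linarith)
        rw [Real.log_mul (hq j k).ne' (by norm_num)] at this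
        linarith [le_max_right (Real.log (q i j)) (Real.log (q j k))]
      · have := Real.log_le_log (hq i k) (show q i k ≤ q i j * 4 by linarith)
        rw [Real.log_mul (hq i j).ne' (by norm_num)] at this
        linarith [le_max_left (Real.log (q i j)) (Real.log (q j k))])
  refine ⟨β, hβ, fun i j => ?_⟩
  by_cases hij : i = j
  · subst hij
    rw [cutFnCone_diag hβ, add_self_div_two, sub_self, sub_zero, abs_zero]
    positivity
  · have := hb i (Finset.mem_univ _) j (Finset.mem_univ _) hij
    simp only [hlog] at this
    convert this using 2
    ring

/-! ### Finite generation of integral polyhedral cones -/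

/-- The integer vectors viewed as real vectors. -/
def castVec {ι : Type} (v : ι → ℤ) : ι → ℝ := fun k => (v k : ℝ)

/-- The cone generated by finitely many integer vectors. -/
def intHull {ι : Type} (s : Finset (ι → ℤ)) : PointedCone ℝ (ι → ℝ) :=
  PointedCone.hull ℝ (castVec '' (s : Set (ι → ℤ)))

theorem castVec_mem_intHull {ι : Type} {s : Finset (ι → ℤ)} {v : ι → ℤ} (hv : v ∈ s) :
    castVec v ∈ intHull s :=
  PointedCone.subset_hull ⟨v, hv, rfl⟩

theorem exists_sum_of_mem_intHull {ι : Type} {s : Finset (ι → ℤ)} {x : ι → ℝ}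
    (hx : x ∈ intHull s) :
    ∃ c : (ι → ℤ) → ℝ, (∀ v, 0 ≤ c v) ∧ x = ∑ v ∈ s, c v • castVec v := by
  obtain ⟨c, hc⟩ := (Submodule.mem_span_image_finset_iff_exists_fun _).1 hx
  classical
  refine ⟨fun v => if h : v ∈ s then c ⟨v, h⟩ else 0, fun v => ?_, ?_⟩
  · dsimp only
    split_ifs with h
    · exact (c ⟨v, h⟩).2
    · exact le_rfl
  · rw [← hc, ← Finset.sum_coe_sort s]
    refine Finset.sum_congr rfl fun v _ => ?_
    beta_reduce
    rw [dif_pos v.2]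
    rfl

theorem isFinGenIntegral_univ (ι : Type) [Fintype ι] [DecidableEq ι] :
    IsFinGenIntegral (Set.univ : Set (ι → ℝ)) := by
  let s : Finset (ι → ℤ) := Finset.univ.image (fun i => Pi.single i 1) ∪
    Finset.univ.image (fun i => Pi.single i (-1))
  refine ⟨s, (Set.eq_univ_of_forall fun x => ?_).symm⟩
  change x ∈ intHull s
  have hx : x = ∑ i, Pi.single i (x i) := (Finset.univ_sum_single x).symm
  rw [hx]
  refine sum_mem fun i _ => ?_
  rcases le_total 0 (x i) with h | h
  · have : (Pi.single i (x i) : ι → ℝ) = x i • castVec (Pi.single i 1) := by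
      ext k
      by_cases hk : k = i
      · subst hk; simp [castVec]
      · simp [castVec, hk]
    rw [this]
    exact PointedCone.smul_mem _ h (castVec_mem_intHull (by simp [s]))
  · have : (Pi.single i (x i) : ι → ℝ) = (-x i) • castVec (Pi.single i (-1)) := by
      ext k
      by_cases hk : k = i
      · subst hk; simp [castVec]
      · simp [castVec, hk]
    rw [this]
    exact PointedCone.smul_mem _ (by linarith) (castVec_mem_intHull (by simp [s]))

open Matrix in
/-- One step of the double description method. -/
theorem IsFinGenIntegral.inter_halfspace {ι : Type} [Fintype ι] [DecidableEq ι] {C : Set (ι → ℝ)}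
    (hC : IsFinGenIntegral C) (a : ι → ℤ) :
    IsFinGenIntegral {x | x ∈ C ∧ castVec a ⬝ᵥ x ≤ 0} := by
  obtain ⟨s, rfl⟩ := hC
  have hcast : ∀ v : ι → ℤ, castVec a ⬝ᵥ castVec v = ((a ⬝ᵥ v : ℤ) : ℝ) := fun v => by
    simp [castVec, dotProduct]
  let pos := s.filter fun v => 0 < a ⬝ᵥ v
  let neg := s.filter fun v => a ⬝ᵥ v < 0
  let zer := s.filter fun v => a ⬝ᵥ v = 0
  -- For `g` in `pos` and `h` in `neg`, this is a nonnegative integer combination lying on the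
  -- hyperplane `a = 0`.
  let comb : (ι → ℤ) × (ι → ℤ) → ι → ℤ := fun e => (a ⬝ᵥ e.1) • e.2 + (-(a ⬝ᵥ e.2)) • e.1
  let t := (neg ∪ zer) ∪ (pos ×ˢ neg).image comb
  have hcomb : ∀ g h, castVec (comb (g, h)) =
      ((a ⬝ᵥ g : ℤ) : ℝ) • castVec h + (-((a ⬝ᵥ h : ℤ) : ℝ)) • castVec g := fun g h => by
    ext k
    simp [comb, castVec]
  refine ⟨t, Set.Subset.antisymm ?_ ?_⟩
  · rintro x ⟨hx, hax⟩
    change x ∈ intHull t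
    obtain ⟨c, hc, hxc⟩ := exists_sum_of_mem_intHull (s := s) hx
    set P := ∑ g ∈ pos, c g * ((a ⬝ᵥ g : ℤ) : ℝ) with hP
    set N := ∑ h ∈ neg, c h * (-((a ⬝ᵥ h : ℤ) : ℝ)) with hN
    have split : ∀ {M : Type} [AddCommMonoid M] (f : (ι → ℤ) → M),
        ∑ v ∈ s, f v = ∑ v ∈ pos, f v + (∑ v ∈ neg, f v + ∑ v ∈ zer, f v) := by
      intro M _ f
      rw [← Finset.sum_union, ← Finset.sum_union]
      · refine Finset.sum_congr ?_ fun _ _ => rfl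
        ext v
        have := lt_trichotomy (a ⬝ᵥ v) 0
        simp only [pos, neg, zer, Finset.mem_union, Finset.mem_filter]
        tauto
      · rw [Finset.disjoint_left]
        intro v h1 h2
        simp only [pos, neg, zer, Finset.mem_union, Finset.mem_filter] at h1 h2
        omega
      · rw [Finset.disjoint_left]
        intro v h1 h2
        simp only [neg, zer, Finset.mem_filter] at h1 h2
        omega
    have hax' : castVec a ⬝ᵥ x = P - N := by
      rw [hxc, dotProduct_sum]
      simp only [dotProduct_smul, hcast, smul_eq_mul]
      rw [split, hP, hN, Finset.sum_eq_zero (s := zer)]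
      · simp only [mul_neg, Finset.sum_neg_distrib]
        ring
      · intro v hv
        rw [(Finset.mem_filter.1 hv).2]
        simp
    have hposmem : ∀ g ∈ pos, 0 < ((a ⬝ᵥ g : ℤ) : ℝ) := fun g hg => by
      exact_mod_cast (Finset.mem_filter.1 hg).2
    have hP0 : 0 ≤ P := Finset.sum_nonneg fun g hg => mul_nonneg (hc g) (hposmem g hg).le
    have hnegmem : ∑ v ∈ neg, c v • castVec v ∈ intHull t := sum_mem fun v hv =>
      PointedCone.smul_mem _ (hc v) (castVec_mem_intHull (by simp [t, hv]))
    have hzermem : ∑ v ∈ zer, c v • castVec v ∈ intHull t := sum_mem fun v hv =>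
      PointedCone.smul_mem _ (hc v) (castVec_mem_intHull (by simp [t, hv]))
    rcases hP0.eq_or_lt with h0 | h0
    · have hz : ∑ v ∈ pos, c v • castVec v = 0 := by
        refine Finset.sum_eq_zero fun g hg => ?_
        have := (Finset.sum_eq_zero_iff_of_nonneg fun g hg =>
          mul_nonneg (hc g) (hposmem g hg).le).1 h0.symm g hg
        rcases mul_eq_zero.1 this with h | h
        · rw [h, zero_smul]
        · exact absurd h (hposmem g hg).ne'
      rw [hxc, split, hz, zero_add]
      exact add_mem hnegmem hzermem
    · have hNP : P ≤ N := by linarith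
      have hN0 : 0 < N := by linarith
      have hy : P • (∑ v ∈ neg, c v • castVec v) + N • (∑ v ∈ pos, c v • castVec v)
          ∈ intHull t := by
        have : P • (∑ v ∈ neg, c v • castVec v) + N • (∑ v ∈ pos, c v • castVec v) =
            ∑ g ∈ pos, ∑ h ∈ neg, (c g * c h) • castVec (comb (g, h)) := by
          simp only [hcomb, smul_add, Finset.sum_add_distrib]
          congr 1
          · rw [hP, Finset.sum_smul]
            refine Finset.sum_congr rfl fun g _ => ?_
            rw [Finset.smul_sum]
            refine Finset.sum_congr rfl fun h _ => ?_
            rw [smul_smul, smul_smul]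
            congr 1
            ring
          · rw [Finset.sum_comm, hN, Finset.sum_smul]
            refine Finset.sum_congr rfl fun g _ => ?_
            rw [Finset.smul_sum]
            refine Finset.sum_congr rfl fun h _ => ?_
            rw [smul_smul, smul_smul]
            congr 1
            ring
        rw [this]
        refine sum_mem fun g hg => sum_mem fun h hh =>
          PointedCone.smul_mem _ (mul_nonneg (hc g) (hc h)) (castVec_mem_intHull ?_)
        simp only [t, Finset.mem_union, Finset.mem_image, Finset.mem_product]
        exact Or.inr ⟨(g, h), ⟨hg, hh⟩, rfl⟩
      -- All of the positive part is paired with the fraction `P / N` of the negative part; `P ≤ N`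
      -- leaves a nonnegative remainder.
      have hx' : x = N⁻¹ • ((P • (∑ v ∈ neg, c v • castVec v) +
          N • (∑ v ∈ pos, c v • castVec v)) + ((N - P) • (∑ v ∈ neg, c v • castVec v) +
          N • ∑ v ∈ zer, c v • castVec v)) := by
        rw [eq_inv_smul_iff₀ hN0.ne', hxc, split]
        module
      rw [hx']
      exact PointedCone.smul_mem _ (inv_nonneg.2 hN0.le) (add_mem hy (add_mem
        (PointedCone.smul_mem _ (by linarith) hnegmem) (PointedCone.smul_mem _ hN0.le hzermem)))
  · intro x hx
    have hx' : x ∈ intHull t := hx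
    clear hx
    have hle : intHull t ≤ intHull s := by
      refine Submodule.span_le.2 ?_
      rintro _ ⟨v, hv, rfl⟩
      have hv' : v ∈ t := hv
      simp only [t, Finset.mem_union, Finset.mem_image, Finset.mem_product] at hv'
      rcases hv' with (h | h) | ⟨⟨g, h⟩, ⟨hg, hh⟩, rfl⟩
      · exact castVec_mem_intHull (Finset.mem_filter.1 h).1
      · exact castVec_mem_intHull (Finset.mem_filter.1 h).1
      · rw [hcomb]
        obtain ⟨hg1, hg2⟩ := Finset.mem_filter.1 hg
        obtain ⟨hh1, hh2⟩ := Finset.mem_filter.1 hh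
        refine add_mem (PointedCone.smul_mem _ ?_ (castVec_mem_intHull hh1))
          (PointedCone.smul_mem _ ?_ (castVec_mem_intHull hg1))
        · exact_mod_cast hg2.le
        · have : ((a ⬝ᵥ h : ℤ) : ℝ) ≤ 0 := by exact_mod_cast hh2.le
          linarith
    refine ⟨hle hx', ?_⟩
    induction hx' using Submodule.span_induction with
    | mem x hx =>
      obtain ⟨v, hv, rfl⟩ := hx
      have hv' : v ∈ t := hv
      simp only [t, Finset.mem_union, Finset.mem_image, Finset.mem_product] at hv'
      rcases hv' with (h | h) | ⟨⟨g, h⟩, ⟨hg, hh⟩, rfl⟩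
      · rw [hcast]
        exact_mod_cast (Finset.mem_filter.1 h).2.le
      · rw [hcast]
        exact_mod_cast (Finset.mem_filter.1 h).2.le
      · rw [hcomb, dotProduct_add, dotProduct_smul, dotProduct_smul, hcast, hcast]
        refine le_of_eq ?_
        simp only [smul_eq_mul]
        ring
    | zero => simp
    | add x y _ _ hx hy => rw [dotProduct_add]; linarith
    | smul c x _ hx =>
      have : castVec a ⬝ᵥ (c • x) = c * (castVec a ⬝ᵥ x) := dotProduct_smul (c : ℝ) _ _
      rw [this]
      exact mul_nonpos_of_nonneg_of_nonpos c.2 hx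

/-- Weyl's theorem over the integers: integral polyhedral cones are finitely generated. -/
theorem IsIntegralPolyhedral.isFinGenIntegral {ι : Type} [Fintype ι] {C : Set (ι → ℝ)}
    (hC : IsIntegralPolyhedral C) : IsFinGenIntegral C := by
  classical
  obtain ⟨s, rfl⟩ := hC
  induction s using Finset.induction_on with
  | empty => simpa using isFinGenIntegral_univ ι
  | insert a s _ ih =>
    convert ih.inter_halfspace a using 1
    ext x
    simp only [Finset.mem_insert, forall_eq_or_imp, Set.mem_ofPred_eq]
    exact and_comm

/-! ### Cut matrices and reduced bounded ratios -/

open Matrix in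
/-- Matrices realizing an arbitrary diagonal scaling of a multiple of a cut vector. -/
theorem exp_cut_mem_LorentzianPos {n : ℕ} (x : Fin n → ℝ) {τ : ℝ} (hτ : 0 ≤ τ)
    (S : Finset (Fin n)) :
    (fun i j => Real.exp (x i + x j + τ * cutFn S (i, j)) : Matrix (Fin n) (Fin n) ℝ)
      ∈ LorentzianPos n := by
  set p : Matrix (Fin n) (Fin n) ℝ := fun i j => Real.exp (x i + x j + τ * cutFn S (i, j)) with hp
  have hherm : p.IsHermitian := by
    refine Matrix.IsHermitian.ext fun i j => ?_
    simp only [hp, cutFn, star_trivial, iff_comm, add_comm]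
  refine ⟨⟨fun i j => (Real.exp_pos _).le, hherm, ?_⟩, fun i j => Real.exp_pos _⟩
  rw [card_pos_eigenvalues_le_one_iff]
  refine ⟨fun i => Real.exp (x i), fun v hv => ?_⟩
  have hτ' : 0 ≤ Real.exp τ - 1 := by linarith [Real.one_le_exp hτ]
  let s : Fin n → ℝ := fun i => if i ∈ S then 1 else 0
  have hentry : ∀ i j, p i j = Real.exp (x i) * Real.exp (x j) *
      (1 + (Real.exp τ - 1) * (s i + s j - 2 * (s i * s j))) := by
    intro i j
    rw [← Real.exp_add]
    by_cases hi : i ∈ S <;> by_cases hj : j ∈ S <;>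
      simp [hp, cutFn, s, hi, hj, Real.exp_add] <;> norm_num
  let u : Fin n → ℝ := fun i => Real.exp (x i) * v i
  have hu : ∑ i, u i = 0 := hv
  -- The cut is `s i + s j - 2 * s i * s j` for the indicator `s`, so on `∑ u = 0` only a
  -- nonpositive multiple of a square survives.
  have hQ : v ⬝ᵥ p *ᵥ v = (∑ i, u i) * (∑ i, u i) + (Real.exp τ - 1) *
      (2 * ((∑ i, s i * u i) * (∑ i, u i)) - 2 * ((∑ i, s i * u i) * (∑ i, s i * u i))) := by
    have h1 : v ⬝ᵥ p *ᵥ v = ∑ i, ∑ j, (u i * u j + (Real.exp τ - 1) *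
        ((s i * u i) * u j + u i * (s j * u j) - 2 * ((s i * u i) * (s j * u j)))) := by
      simp only [dotProduct, mulVec, Finset.mul_sum]
      refine Finset.sum_congr rfl fun i _ => Finset.sum_congr rfl fun j _ => ?_
      rw [hentry]
      simp only [u]
      ring
    rw [h1]
    simp only [Finset.sum_add_distrib, Finset.sum_sub_distrib, ← Finset.mul_sum, ← Finset.sum_mul]
    ring
  rw [hQ, hu]
  nlinarith [mul_nonneg hτ' (mul_self_nonneg (∑ i, s i * u i))]

theorem prod_rpow_eq_exp {ι : Type} [Fintype ι] {f α : ι → ℝ} (hf : ∀ e, 0 < f e) :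
    ∏ e, f e ^ α e = Real.exp (∑ e, α e * Real.log (f e)) := by
  rw [Real.exp_sum]
  refine Finset.prod_congr rfl fun e _ => ?_
  rw [Real.rpow_def_of_pos (hf e), mul_comm]

theorem nonpos_of_forall_mul_le {a b : ℝ} (h : ∀ τ : ℝ, 0 ≤ τ → τ * a ≤ b) : a ≤ 0 := by
  by_contra! ha
  have h0 : 0 ≤ b := by simpa using h 0 le_rfl
  have h1 := h ((b + 1) / a) (by positivity)
  rw [div_mul_cancel₀ _ ha.ne'] at h1
  linarith

/-- The map `φ` lets one argument serve both strict and weak pairs. -/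
theorem sum_mul_nonpos_of_mem_cutFnCone {n : ℕ} {ι : Type} [Fintype ι] {φ : ι → Fin n × Fin n}
    {α : ι → ℝ} (hα : ∀ S, ∑ e, α e * cutFn S (φ e) ≤ 0) {β : Fin n × Fin n → ℝ}
    (hβ : β ∈ cutFnCone (Fin n)) : ∑ e, α e * β (φ e) ≤ 0 := by
  induction hβ using Submodule.span_induction with
  | mem x hx => obtain ⟨S, rfl⟩ := hx; exact hα S
  | zero => simp
  | add x y _ _ hx hy =>
    simp only [Pi.add_apply, mul_add, Finset.sum_add_distrib]
    linarith
  | smul c x _ hx =>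
    have : ∑ e, α e * (c • x) (φ e) = c * ∑ e, α e * x (φ e) := by
      rw [Finset.mul_sum]
      refine Finset.sum_congr rfl fun e _ => ?_
      have : (c • x) (φ e) = c * x (φ e) := rfl
      rw [this]
      ring
    rw [this]
    exact mul_nonpos_of_nonneg_of_nonpos c.2 hx

/-- Exponents satisfying the cut inequalities are bounded on normalized entries. -/
theorem exists_sum_log_le {n : ℕ} {ι : Type} [Fintype ι] {φ : ι → Fin n × Fin n} {α : ι → ℝ}
    (hα : ∀ S, ∑ e, α e * cutFn S (φ e) ≤ 0) : ∃ B : ℝ, ∀ p ∈ LorentzianPos n,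
      ∑ e, α e * (Real.log (p (φ e).1 (φ e).2) -
        (Real.log (p (φ e).1 (φ e).1) + Real.log (p (φ e).2 (φ e).2)) / 2) ≤ B := by
  obtain ⟨C, hC⟩ := exists_cutFnCone_near_log n
  refine ⟨∑ e, |α e| * C, fun p hp => ?_⟩
  obtain ⟨β, hβ, hb⟩ := hC p hp
  have h1 := sum_mul_nonpos_of_mem_cutFnCone hα hβ
  refine (le_of_sub_nonneg ?_ : _ ≤ ∑ e, (|α e| * C + α e * β (φ e))).trans ?_
  · rw [← Finset.sum_sub_distrib]
    refine Finset.sum_nonneg fun e _ => ?_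
    have h2 := mul_le_mul_of_nonneg_left (hb (φ e).1 (φ e).2) (abs_nonneg (α e))
    rw [← abs_mul] at h2
    have h3 := (le_abs_self _).trans h2
    rw [mul_sub] at h3
    linarith
  · rw [Finset.sum_add_distrib]
    linarith

theorem mem_reducedBR_iff {n : ℕ} {α : StrictPair n → ℝ} :
    α ∈ reducedBR (LorentzianPos n) ↔ ∀ S, ∑ e, α e * cutVector S e ≤ 0 := by
  constructor
  · rintro ⟨c, -, hc⟩ S
    refine nonpos_of_forall_mul_le (b := Real.log c) fun τ hτ => ?_
    have hp := exp_cut_mem_LorentzianPos (0 : Fin n → ℝ) hτ S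
    have h := hc _ ⟨hp, fun i => by simp [cutFn]⟩
    rw [prod_rpow_eq_exp fun e => Real.exp_pos _] at h
    have h' := Real.log_le_log (Real.exp_pos _) h
    rw [Real.log_exp] at h'
    refine le_trans (le_of_eq ?_) h'
    rw [Finset.mul_sum]
    refine Finset.sum_congr rfl fun e _ => ?_
    rw [Real.log_exp]
    simp only [Pi.zero_apply, cutFn, cutVector]
    ring
  · intro hα
    obtain ⟨B, hB⟩ := exists_sum_log_le (φ := fun e : StrictPair n => e.1) hα
    refine ⟨Real.exp B, Real.exp_pos _, fun p hp => ?_⟩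
    rw [prod_rpow_eq_exp fun e => hp.1.2 _ _]
    refine Real.exp_le_exp.2 ?_
    simpa [hp.2] using hB p hp.1

theorem reducedBR_eq (n : ℕ) : reducedBR (LorentzianPos n) =
    {α : StrictPair n → ℝ | ∀ β ∈ cutCone n, ∑ e, α e * β e ≤ 0} := by
  ext α
  rw [mem_reducedBR_iff]
  constructor
  · intro hα β hβ
    induction hβ using Submodule.span_induction with
    | mem x hx => obtain ⟨S, rfl⟩ := hx; exact hα S
    | zero => simp
    | add x y _ _ hx hy =>
      simp only [Pi.add_apply, mul_add, Finset.sum_add_distrib]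
      linarith
    | smul c x _ hx =>
      have : ∑ e, α e * (c • x) e = c * ∑ e, α e * x e := by
        rw [Finset.mul_sum]
        refine Finset.sum_congr rfl fun e _ => ?_
        have : (c • x) e = c * x e := rfl
        rw [this]
        ring
      rw [this]
      exact mul_nonpos_of_nonneg_of_nonpos c.2 hx
  · exact fun h S => h _ (PointedCone.subset_hull ⟨S, rfl⟩)

/-! ### Unreduced bounded ratios -/

/-- The multiplicity of `i` in the pair `e`. -/
def incidence {n : ℕ} (i : Fin n) : WeakPair n → ℤ :=
  fun e => (if e.1.1 = i then 1 else 0) + (if e.1.2 = i then 1 else 0)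

/-- The cut vector of `S`, extended by zero to the diagonal. -/
def weakCut {n : ℕ} (S : Finset (Fin n)) : WeakPair n → ℤ :=
  fun e => if (e.1.1 ∈ S ↔ e.1.2 ∈ S) then 0 else 1

theorem sum_incidence_mul {n : ℕ} (α : WeakPair n → ℝ) (y : Fin n → ℝ) :
    ∑ e, α e * (y e.1.1 + y e.1.2) = ∑ i, y i * ∑ e, (incidence i e : ℝ) * α e := by
  simp only [Finset.mul_sum]
  rw [Finset.sum_comm]
  refine Finset.sum_congr rfl fun e _ => ?_
  simp only [incidence, Int.cast_add, Int.cast_ite, Int.cast_one, Int.cast_zero, add_mul, mul_add,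
    Finset.sum_add_distrib, ite_mul, one_mul, zero_mul, mul_ite, mul_zero, Finset.sum_ite_eq,
    Finset.mem_univ, if_true]
  ring

/-- Diagonal scalings form a group, so boundedness along them forces equalities; cuts can only be
scaled upward and give inequalities. -/
theorem mem_BR_iff {n : ℕ} {α : WeakPair n → ℝ} :
    α ∈ BR (LorentzianPos n) ↔
      (∀ i, ∑ e, (incidence i e : ℝ) * α e = 0) ∧ ∀ S, ∑ e, (weakCut S e : ℝ) * α e ≤ 0 := by
  have hcut : ∀ S, ∑ e, (weakCut S e : ℝ) * α e = ∑ e, α e * cutFn S e.1 := fun S => by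
    refine Finset.sum_congr rfl fun e _ => ?_
    rw [mul_comm]
    simp [weakCut, cutFn]
  constructor
  · rintro ⟨c, -, hc⟩
    have key : ∀ (x : Fin n → ℝ) (τ : ℝ) (S : Finset (Fin n)), 0 ≤ τ →
        ∑ i, x i * ∑ e, (incidence i e : ℝ) * α e + τ * ∑ e, (weakCut S e : ℝ) * α e
          ≤ Real.log c := by
      intro x τ S hτ
      have h := hc _ (exp_cut_mem_LorentzianPos x hτ S)
      rw [prod_rpow_eq_exp fun e => Real.exp_pos _] at h
      have h' := Real.log_le_log (Real.exp_pos _) h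
      rw [Real.log_exp] at h'
      refine le_trans (le_of_eq ?_) h'
      rw [← sum_incidence_mul, hcut, Finset.mul_sum, ← Finset.sum_add_distrib]
      refine Finset.sum_congr rfl fun e _ => ?_
      rw [Real.log_exp]
      ring
    refine ⟨fun i => le_antisymm ?_ ?_, fun S => ?_⟩
    · refine nonpos_of_forall_mul_le (b := Real.log c) fun τ _ => ?_
      simpa [Pi.single_apply] using key (Pi.single i τ) 0 ∅ le_rfl
    · refine neg_nonpos.1 (nonpos_of_forall_mul_le (b := Real.log c) fun τ _ => ?_)
      simpa [Pi.single_apply] using key (Pi.single i (-τ)) 0 ∅ le_rfl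
    · refine nonpos_of_forall_mul_le (b := Real.log c) fun τ hτ => ?_
      simpa using key 0 τ S hτ
  · rintro ⟨hdeg, hα⟩
    obtain ⟨B, hB⟩ := exists_sum_log_le (φ := fun e : WeakPair n => e.1)
      fun S => (hcut S).symm.trans_le (hα S)
    refine ⟨Real.exp B, Real.exp_pos _, fun p hp => ?_⟩
    rw [prod_rpow_eq_exp fun e => hp.2 _ _]
    refine Real.exp_le_exp.2 (le_trans (le_of_eq ?_) (hB p hp))
    -- The incidence equations make the weighted sum of half-diagonal logarithms vanish, so
    -- normalization does not change the ratio.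
    have h0 := sum_incidence_mul α fun i => Real.log (p i i) / 2
    simp only [hdeg, mul_zero, Finset.sum_const_zero] at h0
    rw [← sub_zero (∑ e : WeakPair n, α e * (_ - _)), ← neg_zero, ← h0, sub_neg_eq_add,
      ← Finset.sum_add_distrib]
    refine Finset.sum_congr rfl fun e _ => ?_
    ring

theorem isIntegralPolyhedral_BR (n : ℕ) : IsIntegralPolyhedral (BR (LorentzianPos n)) := by
  classical
  refine ⟨Finset.univ.image incidence ∪ Finset.univ.image (fun i => -incidence i) ∪
    Finset.univ.image weakCut, ?_⟩
  ext α
  rw [mem_BR_iff]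
  constructor
  · rintro ⟨h1, h2⟩ a ha
    simp only [Finset.mem_union, Finset.mem_image, Finset.mem_univ, true_and] at ha
    rcases ha with (⟨i, rfl⟩ | ⟨i, rfl⟩) | ⟨S, rfl⟩
    · exact (h1 i).le
    · simp [h1 i]
    · exact h2 S
  · intro h
    refine ⟨fun i => le_antisymm (h _ (by simp)) ?_, fun S => h _ (by simp)⟩
    have := h (-incidence i) (by simp)
    simpa using this

end LorentzianRatios

theorem theoremB (n : ℕ) :
    LorentzianRatios.reducedBR (LorentzianRatios.LorentzianPos n) =
      {α : LorentzianRatios.StrictPair n → ℝ |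
        ∀ β ∈ LorentzianRatios.cutCone n, ∑ e, α e * β e ≤ 0} ∧
    LorentzianRatios.IsFinGenIntegral (LorentzianRatios.BR (LorentzianRatios.LorentzianPos n)) ∧
    LorentzianRatios.IsIntegralPolyhedral
      (LorentzianRatios.BR (LorentzianRatios.LorentzianPos n)) :=
  ⟨LorentzianRatios.reducedBR_eq n, (LorentzianRatios.isIntegralPolyhedral_BR n).isFinGenIntegral,
    LorentzianRatios.isIntegralPolyhedral_BR n⟩
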